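/- Let $G$ be a finite simple graph with at least one vertex and with no isolated vertices. For a proper edge coloring $\varphi$ of $G$ and a vertex $v$, the palette of $v$ is the set of colors appearing on the edges incident with $v$; the palette index $\check s(G)$ is the minimum, over all proper edge colorings $\varphi$ of $G$, of the number of distinct palettes of vertices of $G$ occurring in $\varphi$. Then $\check s(G)=|V(G)|$ if and only if $G$ is isomorphic to one of the following graphs: 1. the complete graph $K_3$; 2. a star $K_{1,j}$ with $j\ge 2$; 3. the graph $\hat K_3^{j}$ with $j\ge 1$, obtained from $K_3$ and $K_{1,j}$ by identifying the central vertex of $K_{1,j}$ with a vertex of $K_3$; 4. the graph $\hat K_3^{j+}$ with $j\ge 3$, obtained from the disjoint union of $K_3$ and $K_{1,j}$ by adding an edge between the central vertex of $K_{1,j}$ and a vertex of $K_3$; 5. the disjoint union $K_3\cup K_{1,j}$ with $j\ge 3$. -/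

import Mathlib

namespace PaletteIndex

/-- A proper edge coloring of `G` (with natural numbers as colors): a proper vertex coloring of
the line graph, so that distinct edges sharing an endpoint get different colors. -/
abbrev ProperEdgeColoring {V : Type*} (G : SimpleGraph V) : Type _ :=
  G.lineGraph.Coloring ℕ

/-- The palette of `v`: the set of all colors appearing on edges incident with `v`. -/
def palette {V : Type*} {G : SimpleGraph V} (C : ProperEdgeColoring G) (v : V) : Set ℕ :=
  {c | ∃ e : G.edgeSet, v ∈ (e : Sym2 V) ∧ C e = c}

/-- The number of distinct palettes occurring in the coloring `C`. -/
noncomputable def numPalettes {V : Type*} {G : SimpleGraph V} (C : ProperEdgeColoring G) : ℕ :=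
  (Set.range (palette C)).ncard

/-- The palette index of a (finite) graph: the minimum number of distinct palettes occurring in
a proper edge coloring. -/
noncomputable def paletteIndex {V : Type*} (G : SimpleGraph V) : ℕ :=
  sInf {n | ∃ C : ProperEdgeColoring G, numPalettes C = n}

/-- The star `K_{1,j}`; its central vertex is `Sum.inl 0`. -/
abbrev star (j : ℕ) : SimpleGraph (Fin 1 ⊕ Fin j) :=
  completeBipartiteGraph (Fin 1) (Fin j)

/-- The triangle `K_3`. -/
abbrev triangle : SimpleGraph (Fin 3) := ⊤

/-- `K_3` and `K_{1,j}` with the central vertex of `K_{1,j}` identified with the vertex `0` of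
`K_3`: the vertices of the triangle are `Sum.inl a`, the leaves of the star are `Sum.inr i`. -/
def triangleStar (j : ℕ) : SimpleGraph (Fin 3 ⊕ Fin j) where
  Adj
    | Sum.inl a, Sum.inl b => a ≠ b
    | Sum.inl a, Sum.inr _ => a = 0
    | Sum.inr _, Sum.inl b => b = 0
    | Sum.inr _, Sum.inr _ => False
  symm := ⟨by rintro (a | i) (b | k) h <;> first | exact h | exact h.symm⟩
  loopless := ⟨by rintro (a | i) h <;> first | exact h rfl | exact h⟩

/-- The disjoint union of `K_3` and `K_{1,j}` together with an edge between the vertex `0` of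
`K_3` and the central vertex of `K_{1,j}`. -/
def triangleEdgeStar (j : ℕ) : SimpleGraph (Fin 3 ⊕ (Fin 1 ⊕ Fin j)) :=
  SimpleGraph.sum triangle (star j) ⊔ SimpleGraph.edge (Sum.inl 0) (Sum.inr (Sum.inl 0))

end PaletteIndex

namespace PaletteIndex

/-! The palette index is at most $|V|$, with equality exactly when every proper edge coloring gives
distinct vertices distinct palettes. A palette has as many colors as the degree of its vertex, so
only pairs $u, v$ of equal degree matter. Such a pair can be given the same palette by coloring all
edges differently and then identifying the colors at $v$ with those at $u$. This needs a
fixed-point-free bijection from $N(v)\setminus\{u\}$ to $N(u)\setminus\{v\}$, which by Hall's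
theorem fails to exist only if both sets are the same singleton. Hence equality is the degree
condition `TwinCondition` (`paletteIndex_eq_card_iff_twinCondition`).

Under this condition all leaves hang on one vertex $p$, vertices of degree two are pairwise adjacent
with common neighbors, and degrees at least three are pairwise distinct. A vertex of maximal degree
among the large ones then has too few possible neighbors (`eq_empty_of_injOn_degree`), so besides
leaves only a few vertices exist. `TwinCondition.classification` reads off the five families. -/

/-- A graph in which any two distinct vertices of equal degree are either leaves with a common
neighbor or adjacent vertices of degree two with a common neighbor. -/
def TwinCondition {V : Type*} [Fintype V] (G : SimpleGraph V) [DecidableRel G.Adj] : Prop :=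
  ∀ u v, u ≠ v → G.degree u = G.degree v →
    (G.degree u = 1 ∨ (G.degree u = 2 ∧ G.Adj u v)) ∧ ∃ w, G.Adj u w ∧ G.Adj v w

/-! ### Equal palettes and the twin condition -/

section Colorings

variable {V : Type*} {G : SimpleGraph V}

lemma ProperEdgeColoring.eq_of_color_eq (C : ProperEdgeColoring G) {e f : G.edgeSet} {v : V}
    (he : v ∈ (e : Sym2 V)) (hf : v ∈ (f : Sym2 V)) (h : C e = C f) : e = f := by
  by_contra hne
  exact C.valid (v := e) (w := f) ⟨hne, v, he, hf⟩ h

lemma mem_palette_iff (C : ProperEdgeColoring G) (v : V) (c : ℕ) :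
    c ∈ palette C v ↔ ∃ (w : V) (h : G.Adj v w), C ⟨s(v, w), h⟩ = c := by
  constructor
  · rintro ⟨⟨e, he⟩, hv, hc⟩
    obtain ⟨w, rfl⟩ := Sym2.mem_iff_exists.1 hv
    exact ⟨w, he, hc⟩
  · rintro ⟨w, h, hc⟩
    exact ⟨⟨s(v, w), h⟩, Sym2.mem_mk_left v w, hc⟩

lemma ncard_palette [Fintype V] [DecidableRel G.Adj] (C : ProperEdgeColoring G) (v : V) :
    (palette C v).ncard = G.degree v := by
  have key : palette C v = Set.range fun w : G.neighborSet v => C ⟨s(v, w), w.2⟩ := by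
    ext c
    rw [mem_palette_iff]
    constructor
    · rintro ⟨w, h, hc⟩
      exact ⟨⟨w, h⟩, hc⟩
    · rintro ⟨w, hc⟩
      exact ⟨w, w.2, hc⟩
  have hinj : Function.Injective fun w : G.neighborSet v => C ⟨s(v, w), w.2⟩ := by
    intro a b hab
    have := congrArg Subtype.val (C.eq_of_color_eq (Sym2.mem_mk_left v _) (Sym2.mem_mk_left v _) hab)
    exact Subtype.ext (Sym2.congr_right.1 this)
  rw [key, ← Set.image_univ, Set.ncard_image_of_injective _ hinj, Set.ncard_univ,
    Nat.card_eq_fintype_card, SimpleGraph.card_neighborSet_eq_degree]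

/-- If $u, v$ had equal palettes, the color of $uw$, with $w$ a common neighbor, would reappear on
an edge $vx$. Properness at $w$ and at $u$ excludes $x = w$ and $x = u$, so $v$ has one neighbor
more than its degree allows. -/
lemma TwinCondition.palette_injective [Fintype V] [DecidableRel G.Adj] (hG : TwinCondition G)
    (C : ProperEdgeColoring G) : Function.Injective (palette C) := by
  intro u v huv
  by_contra hne
  have hdeg : G.degree u = G.degree v := by rw [← ncard_palette C, huv, ncard_palette]
  obtain ⟨hd, w, huw, hvw⟩ := hG u v hne hdeg
  have hmem : C ⟨s(u, w), huw⟩ ∈ palette C v := by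
    rw [← huv, mem_palette_iff]
    exact ⟨w, huw, rfl⟩
  obtain ⟨x, hvx, hx⟩ := (mem_palette_iff C v _).1 hmem
  have hxw : x ≠ w := by
    rintro rfl
    have := congrArg Subtype.val
      (C.eq_of_color_eq (Sym2.mem_mk_right v x) (Sym2.mem_mk_right u x) hx)
    exact hne (Sym2.congr_left.1 this).symm
  have hxu : x ≠ u := by
    rintro rfl
    have : s(v, x) = s(x, w) := congrArg Subtype.val
      (C.eq_of_color_eq (Sym2.mem_mk_right v x) (Sym2.mem_mk_left x w) hx)
    rw [Sym2.eq_swap] at this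
    exact hvw.ne (Sym2.congr_right.1 this)
  classical
  have hsub : ({x, w} : Finset V) ⊆ G.neighborFinset v := by
    simp [Finset.insert_subset_iff, hvx, hvw]
  have h2 := Finset.card_le_card hsub
  rw [Finset.card_pair hxw, SimpleGraph.card_neighborFinset_eq_degree] at h2
  obtain h1 | ⟨h3, hadj⟩ := hd
  · omega
  · have hsub : ({u, x, w} : Finset V) ⊆ G.neighborFinset v := by
      simp [Finset.insert_subset_iff, hvx, hvw, hadj.symm]
    have h4 := Finset.card_le_card hsub
    rw [Finset.card_eq_three.2 ⟨u, x, w, hxu.symm, huw.ne, hxw, rfl⟩,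
      SimpleGraph.card_neighborFinset_eq_degree] at h4
    omega

lemma exists_coloring_of_countable {α : Type*} [Countable α] (g : Sym2 V → α)
    (hg : ∀ (x y z : V), G.Adj x y → G.Adj x z → y ≠ z → g s(x, y) ≠ g s(x, z)) :
    ∃ C : ProperEdgeColoring G, ∀ e f : G.edgeSet, C e = C f ↔ g e = g f := by
  obtain ⟨i, hi⟩ := Countable.exists_injective_nat α
  refine ⟨SimpleGraph.Coloring.mk (fun e => i (g e)) ?_, fun e f => hi.eq_iff⟩
  rintro ⟨e, he⟩ ⟨f, hf⟩ ⟨hne, x, hxe, hxf⟩ h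
  obtain ⟨y, rfl⟩ := Sym2.mem_iff_exists.1 hxe
  obtain ⟨z, rfl⟩ := Sym2.mem_iff_exists.1 hxf
  refine hg x y z he hf ?_ (hi h)
  rintro rfl
  exact hne rfl

lemma exists_properEdgeColoring [Finite V] (G : SimpleGraph V) : Nonempty (ProperEdgeColoring G) := by
  obtain ⟨C, -⟩ := exists_coloring_of_countable (G := G) (id : Sym2 V → Sym2 V)
    fun x y z _ _ hne h => hne (Sym2.congr_right.1 h)
  exact ⟨C⟩

lemma paletteIndex_eq_card_iff [Finite V] (G : SimpleGraph V) :
    paletteIndex G = Nat.card V ↔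
      ∀ C : ProperEdgeColoring G, Function.Injective (palette C) := by
  have hle (C : ProperEdgeColoring G) : numPalettes C ≤ Nat.card V := by
    rw [numPalettes, ← Set.image_univ, ← Set.ncard_univ]
    exact Set.ncard_image_le
  have hiff (C : ProperEdgeColoring G) :
      numPalettes C = Nat.card V ↔ Function.Injective (palette C) := by
    rw [numPalettes, ← Set.image_univ, ← Set.ncard_univ, Set.ncard_image_iff,
      Set.injOn_univ]
  constructor
  · intro h C
    rw [← hiff]
    refine (hle C).antisymm ?_
    rw [← h]
    exact Nat.sInf_le ⟨C, rfl⟩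
  · intro h
    obtain ⟨C⟩ := exists_properEdgeColoring G
    -- A coloring must exist here, since the infimum of the empty set is 0.
    have : {n | ∃ C : ProperEdgeColoring G, numPalettes C = n} = {Nat.card V} := by
      ext n
      constructor
      · rintro ⟨C', rfl⟩
        exact (hiff C').2 (h C')
      · rintro rfl
        exact ⟨C, (hiff C).2 (h C)⟩
    rw [paletteIndex, this, csInf_singleton]

/-- Two finite sets of equal size admit a bijection without fixed points, unless they are
the same singleton. -/
lemma exists_bijOn_forall_ne [DecidableEq V] {A B : Finset V} (hcard : A.card = B.card)
    (h : ∀ x, A = {x} → B ≠ {x}) :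
    ∃ τ : V → V, Set.BijOn τ B A ∧ ∀ y ∈ B, τ y ≠ y := by
  -- Hall's condition: for a single $y$, the set $A \setminus \{y\}$ is empty only in the excluded
  -- case; for two distinct elements the sets $A \setminus \{y\}$, $A \setminus \{z\}$ already cover
  -- $A$.
  have hall : ∀ s : Finset B, s.card ≤ (s.biUnion fun y => A.erase y).card := by
    intro s
    have hsB : s.card ≤ A.card := by
      rw [hcard, ← Fintype.card_coe B]
      exact s.card_le_univ
    obtain hs | hs := le_or_gt s.card 1
    · obtain hs | hs := Nat.le_one_iff_eq_zero_or_eq_one.1 hs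
      · omega
      · obtain ⟨y, rfl⟩ := Finset.card_eq_one.1 hs
        rw [Finset.singleton_biUnion, Finset.card_singleton, Nat.one_le_iff_ne_zero,
          Finset.card_ne_zero]
        by_contra hemp
        rw [Finset.not_nonempty_iff_eq_empty, Finset.erase_eq_empty_iff] at hemp
        obtain rfl | hA := hemp
        · simp at hs hsB
        · rw [hA, Finset.card_singleton, eq_comm, Finset.card_eq_one] at hcard
          obtain ⟨b, hb⟩ := hcard
          have hy := y.2
          simp only [hb, Finset.mem_singleton] at hy
          exact h _ hA (hy ▸ hb)
    · obtain ⟨y, hy, z, hz, hyz⟩ := Finset.one_lt_card.1 hs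
      refine hsB.trans (Finset.card_le_card fun a ha => ?_)
      rw [Finset.mem_biUnion]
      by_cases hay : a = y
      · refine ⟨z, hz, Finset.mem_erase.2 ⟨?_, ha⟩⟩
        rintro rfl
        exact hyz (Subtype.ext hay.symm)
      · exact ⟨y, hy, Finset.mem_erase.2 ⟨hay, ha⟩⟩
  obtain ⟨f, hf, hfA⟩ := (Finset.all_card_le_biUnion_card_iff_exists_injective _).1 hall
  let τ : V → V := fun y => if hy : y ∈ B then f ⟨y, hy⟩ else y
  have hτ : ∀ y (hy : y ∈ B), τ y = f ⟨y, hy⟩ := fun y hy => dif_pos hy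
  have hmaps : Set.MapsTo τ B A := by
    intro y hy
    rw [hτ y hy]
    exact Finset.mem_of_mem_erase (hfA _)
  have hinj : Set.InjOn τ B := by
    intro y hy z hz hyz
    rw [hτ y hy, hτ z hz] at hyz
    exact congrArg Subtype.val (hf hyz)
  refine ⟨τ, ⟨hmaps, hinj, Finset.surjOn_of_injOn_of_card_le τ hmaps hinj hcard.le⟩, ?_⟩
  intro y hy
  rw [hτ y hy]
  exact Finset.ne_of_mem_erase (hfA ⟨y, hy⟩)

lemma exists_palette_eq [Fintype V] [DecidableRel G.Adj] {u v : V} (huv : u ≠ v)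
    (hdeg : G.degree u = G.degree v)
    (h : ¬ ((G.degree u = 1 ∨ (G.degree u = 2 ∧ G.Adj u v)) ∧ ∃ w, G.Adj u w ∧ G.Adj v w)) :
    ∃ C : ProperEdgeColoring G, palette C u = palette C v := by
  classical
  set A := (G.neighborFinset u).erase v with hAdef
  set B := (G.neighborFinset v).erase u with hBdef
  have hA : ∀ x, x ∈ A ↔ x ≠ v ∧ G.Adj u x := by simp [hAdef]
  have hB : ∀ x, x ∈ B ↔ x ≠ u ∧ G.Adj v x := by simp [hBdef]
  have hcA : A.card = if G.Adj u v then G.degree u - 1 else G.degree u := by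
    rw [hAdef, Finset.card_erase_eq_ite]
    simp
  have hcB : B.card = if G.Adj u v then G.degree u - 1 else G.degree u := by
    rw [hBdef, Finset.card_erase_eq_ite]
    simp [hdeg, G.adj_comm u v]
  -- If both sets were $\{x\}$, then $x$ would be a common neighbor and the degree would be 1, or 2
  -- with $u, v$ adjacent: the case excluded by `h`.
  obtain ⟨τ, hτ, hτne⟩ := exists_bijOn_forall_ne (hcA.trans hcB.symm) (by
    intro x hAx hBx
    have h1 := (hA x).1 (by simp [hAx])
    have h2 := (hB x).1 (by simp [hBx])
    have hpos : 0 < G.degree u := (G.degree_pos_iff_exists_adj u).2 ⟨x, h1.2⟩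
    refine h ⟨?_, x, h1.2, h2.2⟩
    rw [hAx, Finset.card_singleton] at hcA
    split_ifs at hcA with hadj
    · exact Or.inr ⟨by omega, hadj⟩
    · exact Or.inl hcA.symm)
  -- Each edge is its own color, except that $vy$ receives the color of $u\tau(y)$.
  let g : Sym2 V → Sym2 V := fun e => if he : ∃ y ∈ B, e = s(v, y) then s(u, τ he.choose) else e
  have hg1 : ∀ y ∈ B, g s(v, y) = s(u, τ y) := by
    intro y hy
    have he : ∃ z ∈ B, s(v, y) = s(v, z) := ⟨y, hy, rfl⟩
    have hc : he.choose = y := (Sym2.congr_right.1 he.choose_spec.2).symm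
    simp only [g, dif_pos he, hc]
  have hg2 : ∀ e, (¬ ∃ y ∈ B, e = s(v, y)) → g e = e := fun e he => dif_neg he
  have hgu : ∀ x, g s(u, x) = s(u, x) := by
    intro x
    refine hg2 _ ?_
    rintro ⟨y, hy, he⟩
    have hyu := ((hB y).1 hy).1
    rw [Sym2.eq_iff] at he
    obtain ⟨h1, -⟩ | ⟨h1, -⟩ := he
    · exact huv h1
    · exact hyu h1.symm
  -- The two edges sharing a color are disjoint because $\tau$ has no fixed point; this makes the
  -- coloring proper.
  have hdisj : ∀ y ∈ B, ∀ x, x ∈ s(v, y) → x ∈ s(u, τ y) → False := by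
    intro y hy x hx hx'
    have h1 := ((hB y).1 hy).1
    have h2 := ((hA (τ y)).1 (hτ.mapsTo hy)).1
    have h3 := hτne y hy
    rw [Sym2.mem_iff] at hx hx'
    obtain rfl | rfl := hx <;> obtain h4 | h4 := hx'
    · exact huv h4.symm
    · exact h2 h4.symm
    · exact h1 h4
    · exact h3 h4.symm
  obtain ⟨C, hC⟩ := exists_coloring_of_countable (G := G) g (by
    intro x y z hxy hxz hne hgg
    by_cases h1 : ∃ a ∈ B, s(x, y) = s(v, a) <;> by_cases h2 : ∃ b ∈ B, s(x, z) = s(v, b)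
    · obtain ⟨a, ha, hae⟩ := h1
      obtain ⟨b, hb, hbe⟩ := h2
      rw [hae, hbe, hg1 a ha, hg1 b hb, Sym2.congr_right] at hgg
      rw [hτ.injOn ha hb hgg, ← hbe, Sym2.congr_right] at hae
      exact hne hae
    · obtain ⟨a, ha, hae⟩ := h1
      rw [hae, hg1 a ha, hg2 _ h2] at hgg
      exact hdisj a ha x (hae ▸ Sym2.mem_mk_left x y) (hgg ▸ Sym2.mem_mk_left x z)
    · obtain ⟨b, hb, hbe⟩ := h2
      rw [hbe, hg1 b hb, hg2 _ h1] at hgg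
      exact hdisj b hb x (hbe ▸ Sym2.mem_mk_left x z) (hgg ▸ Sym2.mem_mk_left x y)
    · rw [hg2 _ h1, hg2 _ h2, Sym2.congr_right] at hgg
      exact hne hgg)
  refine ⟨C, Set.ext fun c => ?_⟩
  rw [mem_palette_iff, mem_palette_iff]
  constructor
  · rintro ⟨x, hx, rfl⟩
    by_cases hxv : x = v
    · subst hxv
      refine ⟨u, hx.symm, ?_⟩
      rw [hC]
      exact congrArg g Sym2.eq_swap
    · obtain ⟨y, hy, rfl⟩ := hτ.surjOn ((hA x).2 ⟨hxv, hx⟩)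
      refine ⟨y, ((hB y).1 hy).2, ?_⟩
      rw [hC]
      exact (hg1 y hy).trans (hgu _).symm
  · rintro ⟨y, hy, rfl⟩
    by_cases hyu : y = u
    · subst hyu
      refine ⟨v, hy.symm, ?_⟩
      rw [hC]
      exact congrArg g Sym2.eq_swap
    · have hyB := (hB y).2 ⟨hyu, hy⟩
      refine ⟨τ y, ((hA _).1 (hτ.mapsTo hyB)).2, ?_⟩
      rw [hC]
      exact (hgu _).trans (hg1 y hyB).symm

lemma paletteIndex_eq_card_iff_twinCondition [Fintype V] [DecidableRel G.Adj] :
    paletteIndex G = Nat.card V ↔ TwinCondition G := by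
  rw [paletteIndex_eq_card_iff]
  refine ⟨fun h u v huv hdeg => ?_, fun h C => h.palette_injective C⟩
  by_contra hcon
  obtain ⟨C, hC⟩ := exists_palette_eq huv hdeg hcon
  exact huv (h C hC)

end Colorings

lemma TwinCondition.of_iso {V W : Type*} [Fintype V] [Fintype W] {G : SimpleGraph V}
    {H : SimpleGraph W} [DecidableRel G.Adj] [DecidableRel H.Adj] (f : G ≃g H)
    (hH : TwinCondition H) : TwinCondition G := by
  intro u v huv hdeg
  rw [← f.degree_eq u, ← f.degree_eq v] at hdeg
  obtain ⟨h, w, hw⟩ := hH (f u) (f v) (f.injective.ne huv) hdeg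
  rw [f.degree_eq u, f.map_adj_iff] at h
  refine ⟨h, f.symm w, ?_⟩
  rwa [← f.map_adj_iff, ← f.map_adj_iff (v := v), f.apply_symm_apply]

/-! ### The five families satisfy the twin condition -/

section Models

lemma degree_eq_sum {V : Type*} [Fintype V] (G : SimpleGraph V) [DecidableRel G.Adj] (v : V) :
    G.degree v = ∑ w, if G.Adj v w then 1 else 0 := by
  rw [← SimpleGraph.card_neighborFinset_eq_degree, SimpleGraph.neighborFinset_eq_filter,
    Finset.card_filter]

lemma degree_eq_sum_add_sum {A B : Type*} [Fintype A] [Fintype B] (G : SimpleGraph (A ⊕ B))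
    [DecidableRel G.Adj] (v : A ⊕ B) :
    G.degree v = (∑ a, if G.Adj v (Sum.inl a) then 1 else 0) +
      ∑ b, if G.Adj v (Sum.inr b) then 1 else 0 := by
  rw [degree_eq_sum, Fintype.sum_sum_type]

open Classical in
lemma twinCondition_triangle : TwinCondition triangle := by
  intro u v huv _
  refine ⟨Or.inr ⟨?_, huv⟩, ?_⟩
  · rw [degree_eq_sum, Fin.sum_univ_three]
    fin_cases u <;> simp
  · fin_cases u <;> fin_cases v <;> simp_all [Fin.exists_fin_succ]

section
variable {j : ℕ} [DecidableRel (star j).Adj]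

lemma degree_star_center (a : Fin 1) : (star j).degree (Sum.inl a) = j := by
  rw [degree_eq_sum_add_sum]
  simp

lemma degree_star_leaf (i : Fin j) : (star j).degree (Sum.inr i) = 1 := by
  rw [degree_eq_sum_add_sum]
  simp

lemma twinCondition_star (hj : 2 ≤ j) : TwinCondition (star j) := by
  rintro (u | u) (v | v) huv hdeg <;> simp only [degree_star_center, degree_star_leaf] at hdeg ⊢
  · exact absurd (congrArg _ (Subsingleton.elim u v)) huv
  · omega
  · omega
  · exact ⟨Or.inl trivial, Sum.inl 0, by simp⟩

end

section
variable {j : ℕ}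

lemma triangleStar_adj_inl_inl (a b : Fin 3) :
    (triangleStar j).Adj (Sum.inl a) (Sum.inl b) ↔ a ≠ b := Iff.rfl

lemma triangleStar_adj_inl_inr (a : Fin 3) (i : Fin j) :
    (triangleStar j).Adj (Sum.inl a) (Sum.inr i) ↔ a = 0 := Iff.rfl

lemma triangleStar_adj_inr_inl (a : Fin 3) (i : Fin j) :
    (triangleStar j).Adj (Sum.inr i) (Sum.inl a) ↔ a = 0 := Iff.rfl

lemma triangleStar_adj_inr_inr (i k : Fin j) :
    (triangleStar j).Adj (Sum.inr i) (Sum.inr k) ↔ False := Iff.rfl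

variable [DecidableRel (triangleStar j).Adj]

lemma degree_triangleStar_inl (a : Fin 3) :
    (triangleStar j).degree (Sum.inl a) = if a = 0 then j + 2 else 2 := by
  rw [degree_eq_sum_add_sum]
  simp only [triangleStar_adj_inl_inl, triangleStar_adj_inl_inr, Fin.sum_univ_three]
  fin_cases a <;> simp [add_comm]

lemma degree_triangleStar_inr (i : Fin j) : (triangleStar j).degree (Sum.inr i) = 1 := by
  rw [degree_eq_sum_add_sum]
  simp [triangleStar_adj_inr_inl, triangleStar_adj_inr_inr]

lemma twinCondition_triangleStar (hj : 1 ≤ j) : TwinCondition (triangleStar j) := by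
  rintro (u | u) (v | v) huv hdeg <;>
    simp only [degree_triangleStar_inl, degree_triangleStar_inr] at hdeg ⊢
  · have hne : u ≠ v := fun h => huv (congrArg _ h)
    have hu : u ≠ 0 := by
      rintro rfl
      rw [if_pos rfl, if_neg hne.symm] at hdeg
      omega
    have hv : v ≠ 0 := by
      rintro rfl
      rw [if_pos rfl, if_neg hne] at hdeg
      omega
    exact ⟨Or.inr ⟨if_neg hu, hne⟩, Sum.inl 0, hu, hv⟩
  · split_ifs at hdeg <;> omega
  · split_ifs at hdeg <;> omega
  · exact ⟨Or.inl trivial, Sum.inl 0, rfl, rfl⟩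

end

section
variable {j : ℕ}

lemma triangleEdgeStar_adj (x y : Fin 3 ⊕ (Fin 1 ⊕ Fin j)) :
    (triangleEdgeStar j).Adj x y ↔ (SimpleGraph.sum triangle (star j)).Adj x y ∨
      (x = Sum.inl 0 ∧ y = Sum.inr (Sum.inl 0)) ∨ (x = Sum.inr (Sum.inl 0) ∧ y = Sum.inl 0) := by
  rw [triangleEdgeStar, SimpleGraph.sup_adj, SimpleGraph.edge_adj]
  aesop

section
variable [DecidableRel (triangleEdgeStar j).Adj]

lemma degree_triangleEdgeStar_inl (a : Fin 3) :
    (triangleEdgeStar j).degree (Sum.inl a) = if a = 0 then 3 else 2 := by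
  rw [degree_eq_sum_add_sum, Fintype.sum_sum_type]
  fin_cases a <;> simp [triangleEdgeStar_adj, Fin.sum_univ_three]

lemma degree_triangleEdgeStar_center (a : Fin 1) :
    (triangleEdgeStar j).degree (Sum.inr (Sum.inl a)) = j + 1 := by
  rw [degree_eq_sum_add_sum, Fintype.sum_sum_type]
  simp [triangleEdgeStar_adj, Subsingleton.elim a 0, add_comm]

lemma degree_triangleEdgeStar_leaf (i : Fin j) :
    (triangleEdgeStar j).degree (Sum.inr (Sum.inr i)) = 1 := by
  rw [degree_eq_sum_add_sum, Fintype.sum_sum_type]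
  simp [triangleEdgeStar_adj]

/-- The bound on $j$ keeps the degree $j + 1$ of the star's center above the triangle's degrees 3
and 2. -/
lemma twinCondition_triangleEdgeStar (hj : 3 ≤ j) : TwinCondition (triangleEdgeStar j) := by
  rintro (u | u | u) (v | v | v) huv hdeg <;>
    simp only [degree_triangleEdgeStar_inl, degree_triangleEdgeStar_center,
      degree_triangleEdgeStar_leaf] at hdeg ⊢
  · have hne : u ≠ v := fun h => huv (congrArg _ h)
    have hu : u ≠ 0 := by
      rintro rfl
      rw [if_pos rfl, if_neg hne.symm] at hdeg
      omega
    have hv : v ≠ 0 := by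
      rintro rfl
      rw [if_pos rfl, if_neg hne] at hdeg
      omega
    exact ⟨Or.inr ⟨if_neg hu, by simpa [triangleEdgeStar_adj] using hne⟩, Sum.inl 0,
      by simpa [triangleEdgeStar_adj] using hu, by simpa [triangleEdgeStar_adj] using hv⟩
  · split_ifs at hdeg <;> omega
  · split_ifs at hdeg <;> omega
  · split_ifs at hdeg <;> omega
  · exact absurd (by rw [Subsingleton.elim u v]) huv
  · omega
  · split_ifs at hdeg <;> omega
  · omega
  · exact ⟨Or.inl trivial, Sum.inr (Sum.inl 0), by simp [triangleEdgeStar_adj]⟩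

end

variable [DecidableRel (SimpleGraph.sum triangle (star j)).Adj]

lemma degree_sum_triangle_star_inl (a : Fin 3) :
    (SimpleGraph.sum triangle (star j)).degree (Sum.inl a) = 2 := by
  rw [degree_eq_sum_add_sum, Fintype.sum_sum_type, Fin.sum_univ_three]
  fin_cases a <;> simp

lemma degree_sum_triangle_star_center (a : Fin 1) :
    (SimpleGraph.sum triangle (star j)).degree (Sum.inr (Sum.inl a)) = j := by
  rw [degree_eq_sum_add_sum, Fintype.sum_sum_type]
  simp

lemma degree_sum_triangle_star_leaf (i : Fin j) :
    (SimpleGraph.sum triangle (star j)).degree (Sum.inr (Sum.inr i)) = 1 := by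
  rw [degree_eq_sum_add_sum, Fintype.sum_sum_type]
  simp

lemma twinCondition_sum_triangle_star (hj : 3 ≤ j) :
    TwinCondition (SimpleGraph.sum triangle (star j)) := by
  rintro (u | u | u) (v | v | v) huv hdeg <;>
    simp only [degree_sum_triangle_star_inl, degree_sum_triangle_star_center,
      degree_sum_triangle_star_leaf] at hdeg ⊢
  · have hne : u ≠ v := fun h => huv (congrArg _ h)
    refine ⟨Or.inr ⟨trivial, by simpa using hne⟩, ?_⟩
    have hthird : ∀ a b : Fin 3, ∃ c, a ≠ c ∧ b ≠ c := by decide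
    obtain ⟨w, hwu, hwv⟩ := hthird u v
    exact ⟨Sum.inl w, by simpa using hwu, by simpa using hwv⟩
  · omega
  · omega
  · omega
  · exact absurd (by rw [Subsingleton.elim u v]) huv
  · omega
  · omega
  · omega
  · exact ⟨Or.inl trivial, Sum.inr (Sum.inl 0), by simp⟩

end

end Models

/-! ### Structure of graphs with the twin condition -/

section Structure

lemma nonempty_iso_of_bijective {V W : Type*} {G : SimpleGraph V} {H : SimpleGraph W} {f : W → V}
    (hf : Function.Bijective f) (h : ∀ a b, G.Adj (f a) (f b) ↔ H.Adj a b) :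
    Nonempty (G ≃g H) :=
  ⟨RelIso.symm ⟨Equiv.ofBijective f hf, h _ _⟩⟩

variable {V : Type*} {G : SimpleGraph V}

lemma injective_vec_three {u v w : V} (huv : u ≠ v) (huw : u ≠ w) (hvw : v ≠ w) :
    Function.Injective ![u, v, w] := by
  intro a b
  fin_cases a <;> fin_cases b <;> simp [huv, huw, hvw, huv.symm, huw.symm, hvw.symm]

lemma adj_vec_three_iff {u v w : V} (huv : G.Adj u v) (huw : G.Adj u w) (hvw : G.Adj v w)
    (a b : Fin 3) : G.Adj (![u, v, w] a) (![u, v, w] b) ↔ a ≠ b := by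
  fin_cases a <;> fin_cases b <;> simp [huv, huw, hvw, huv.symm, huw.symm, hvw.symm]

lemma nonempty_iso_triangle {u v w : V} (huv : G.Adj u v) (huw : G.Adj u w) (hvw : G.Adj v w)
    (h : ∀ x, x = u ∨ x = v ∨ x = w) : Nonempty (G ≃g triangle) := by
  refine nonempty_iso_of_bijective (f := ![u, v, w])
    ⟨injective_vec_three huv.ne huw.ne hvw.ne, fun x => ?_⟩ (adj_vec_three_iff huv huw hvw)
  obtain rfl | rfl | rfl := h x
  exacts [⟨0, rfl⟩, ⟨1, rfl⟩, ⟨2, rfl⟩]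

variable [Fintype V] [DecidableRel G.Adj]

/-- A nonempty set of vertices with distinct degrees, all at least three, has a neighborhood
with at least three vertices outside the set. -/
lemma eq_empty_of_injOn_degree [DecidableEq V] {S E : Finset V} (hE : E.card ≤ 2)
    (hS : ∀ x ∈ S, 3 ≤ G.degree x) (hinj : Set.InjOn (fun x => G.degree x) (S : Set V))
    (hadj : ∀ x ∈ S, ∀ y, G.Adj x y → y ∈ S ∪ E) : S = ∅ := by
  by_contra hne
  obtain ⟨x, hx, hmax⟩ := S.exists_max_image (fun x => G.degree x) (Finset.nonempty_iff_ne_empty.2 hne)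
  -- With $D$ the maximal degree in $S$, distinctness gives $|S| \le D - 2$, while counting
  -- neighbors of $x$ gives $D \le (|S| - 1) + 2$.
  have h1 : S.card ≤ (Finset.Icc 3 (G.degree x)).card :=
    Finset.card_le_card_of_injOn (fun x => G.degree x)
      (fun y hy => Finset.mem_coe.2 (Finset.mem_Icc.2 ⟨hS y hy, hmax y hy⟩)) hinj
  have h2 : G.neighborFinset x ⊆ S.erase x ∪ E := by
    intro y hy
    rw [SimpleGraph.mem_neighborFinset] at hy
    have := hadj x hx y hy
    simp only [Finset.mem_union, Finset.mem_erase] at this ⊢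
    exact this.imp_left fun h => ⟨hy.ne', h⟩
  have h3 := (Finset.card_le_card h2).trans (Finset.card_union_le _ _)
  rw [SimpleGraph.card_neighborFinset_eq_degree, Finset.card_erase_of_mem hx] at h3
  have h4 := hS x hx
  have h5 : 0 < S.card := Finset.card_pos.2 ⟨x, hx⟩
  rw [Nat.card_Icc] at h1
  omega

lemma adj_iff_eq_of_degree_eq_one {x p : V} (hx : G.degree x = 1) (hp : G.Adj x p) (y : V) :
    G.Adj x y ↔ y = p := by
  obtain ⟨q, hq⟩ := Finset.card_eq_one.1 hx
  have key : ∀ z, G.Adj x z ↔ z = q := fun z => by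
    rw [← SimpleGraph.mem_neighborFinset, hq, Finset.mem_singleton]
  rw [key, (key p).1 hp]

lemma adj_iff_of_degree_eq_two {x p q : V} (hx : G.degree x = 2) (hp : G.Adj x p)
    (hq : G.Adj x q) (hpq : p ≠ q) (y : V) : G.Adj x y ↔ y = p ∨ y = q := by
  classical
  have hsub : {p, q} ⊆ G.neighborFinset x := by simp [Finset.insert_subset_iff, hp, hq]
  have := Finset.eq_of_subset_of_card_le hsub (by
    rw [Finset.card_pair hpq, SimpleGraph.card_neighborFinset_eq_degree, hx])
  rw [← SimpleGraph.mem_neighborFinset, ← this, Finset.mem_insert, Finset.mem_singleton]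

/-- `p` is the neighbor of every leaf of `G`. -/
def IsLeafCenter (G : SimpleGraph V) [DecidableRel G.Adj] (p : V) : Prop :=
  ∀ x, G.degree x = 1 → ∀ y, G.Adj x y ↔ y = p

/-- Any two leaves share their only neighbor. In a leafless graph every vertex qualifies vacuously,
and the given $w$ is chosen. -/
lemma TwinCondition.exists_isLeafCenter (hT : TwinCondition G) (w : V) :
    ∃ p, IsLeafCenter G p ∧ (p = w ∨ ∃ x, G.degree x = 1) := by
  by_cases h : ∃ l, G.degree l = 1
  · obtain ⟨l, hl⟩ := h
    obtain ⟨p, hp⟩ := (G.degree_pos_iff_exists_adj l).1 (by omega)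
    refine ⟨p, fun x hx => adj_iff_eq_of_degree_eq_one hx ?_, Or.inr ⟨l, hl⟩⟩
    by_cases hxl : x = l
    · exact hxl ▸ hp
    · obtain ⟨-, q, hxq, hlq⟩ := hT x l hxl (hx.trans hl.symm)
      rwa [← (adj_iff_eq_of_degree_eq_one hl hp q).1 hlq]
  · exact ⟨w, fun x hx => absurd ⟨x, hx⟩ h, Or.inl rfl⟩

lemma IsLeafCenter.degree_ne_one {p : V} (hp : IsLeafCenter G p) : G.degree p ≠ 1 :=
  fun h => G.irrefl ((hp p h p).2 rfl)

/-- The vertices of degree at least three other than $p, w$ have distinct degrees. They touch no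
leaf, since leaves see only $p$, and by `h2` no vertex of degree two except possibly $w$; so
`eq_empty_of_injOn_degree` applies with $E = \{p, w\}$. -/
lemma TwinCondition.eq_or_eq_of_three_le_degree (hT : TwinCondition G)
    (hpos : ∀ x, 0 < G.degree x) {p w : V} (hp : IsLeafCenter G p)
    (h2 : ∀ x y, G.Adj x y → 3 ≤ G.degree x → G.degree y = 2 → x = w ∨ y = w) {x : V}
    (hx : 3 ≤ G.degree x) : x = p ∨ x = w := by
  classical
  by_contra hcon
  have hempty := eq_empty_of_injOn_degree (G := G) (E := {p, w})
    (S := Finset.univ.filter fun x => 3 ≤ G.degree x ∧ ¬ (x = p ∨ x = w)) Finset.card_le_two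
    (fun x hx => (Finset.mem_filter.1 hx).2.1) (by
      intro x hx y hy hxy
      by_contra hne
      have := (hT x y hne hxy).1
      have := (Finset.mem_filter.1 hx).2.1
      omega) (by
      intro x hx y hxy
      obtain ⟨-, hx3, hx⟩ := Finset.mem_filter.1 hx
      by_cases hy : y = p ∨ y = w
      · exact Finset.mem_union_right _ (by simpa using hy)
      · refine Finset.mem_union_left _ (Finset.mem_filter.2 ⟨Finset.mem_univ _, ?_, hy⟩)
        by_contra hlt
        have := hpos y
        obtain h | h : G.degree y = 1 ∨ G.degree y = 2 := by omega
        · exact hx (Or.inl ((hp y h x).1 hxy.symm))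
        · exact (h2 x y hxy hx3 h).elim (fun h => hx (Or.inr h)) fun h => hy (Or.inr h))
  exact (Finset.eq_empty_iff_forall_notMem.1 hempty) x
    (Finset.mem_filter.2 ⟨Finset.mem_univ _, hx, hcon⟩)

variable (G) in
-- The last clause, applied to the leaf center, turns a lower bound on its degree into one on $j$.
lemma exists_leaf_enumeration : ∃ (j : ℕ) (e : Fin j → V), Function.Injective e ∧
    (∀ i, G.degree (e i) = 1) ∧ (∀ x, G.degree x = 1 → ∃ i, e i = x) ∧
    ∀ (x : V) (E : Finset V), (∀ y, G.Adj x y → G.degree y = 1 ∨ y ∈ E) →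
      G.degree x ≤ j + E.card := by
  classical
  let L := Finset.univ.filter fun x => G.degree x = 1
  have hL : ∀ x, x ∈ L ↔ G.degree x = 1 := by simp [L]
  refine ⟨L.card, fun i => L.equivFin.symm i, ?_, ?_, ?_, ?_⟩
  · exact Subtype.val_injective.comp L.equivFin.symm.injective
  · exact fun i => (hL _).1 (L.equivFin.symm i).2
  · exact fun x hx => ⟨L.equivFin ⟨x, (hL x).2 hx⟩, by simp⟩
  · intro x E h
    rw [← SimpleGraph.card_neighborFinset_eq_degree]
    refine (Finset.card_le_card (t := L ∪ E) fun y hy => ?_).trans (Finset.card_union_le _ _)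
    rw [Finset.mem_union, hL]
    exact h y ((G.mem_neighborFinset x y).1 hy)

/-! ### Isomorphisms with the star and triangle-star families -/

section Assembly

lemma IsLeafCenter.not_adj_leaves {p x y : V} (hp : IsLeafCenter G p) (hx : G.degree x = 1)
    (hy : G.degree y = 1) : ¬ G.Adj x y := fun h =>
  hp.degree_ne_one ((hp x hx y).1 h ▸ hy)

lemma exists_iso_star (hpos : ∀ x, 0 < G.degree x) {p : V} (hp : IsLeafCenter G p)
    (h : ∀ x, x ≠ p → G.degree x = 1) : ∃ j : ℕ, 2 ≤ j ∧ Nonempty (G ≃g star j) := by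
  obtain ⟨j, e, he, hdeg, hsurj, hle⟩ := exists_leaf_enumeration G
  have hpe : ∀ i, p ≠ e i := fun i hi => hp.degree_ne_one (hi ▸ hdeg i)
  have hpadj : ∀ i, G.Adj (e i) p := fun i => (hp _ (hdeg i) p).2 rfl
  refine ⟨j, ?_, nonempty_iso_of_bijective (f := Sum.elim (fun _ => p) e) ⟨?_, ?_⟩ ?_⟩
  · have h1 := hle p ∅ fun y hy => Or.inl (h y hy.ne')
    have h2 := hp.degree_ne_one
    have h3 := hpos p
    rw [Finset.card_empty] at h1
    omega
  · exact Function.Injective.sumElim (Function.injective_of_subsingleton _) he fun _ i => hpe i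
  · intro x
    by_cases hx : x = p
    · exact ⟨Sum.inl 0, hx.symm⟩
    · obtain ⟨i, hi⟩ := hsurj x (h x hx)
      exact ⟨Sum.inr i, hi⟩
  · rintro (a | i) (b | k)
    · simp
    · simpa using (hpadj k).symm
    · simpa using hpadj i
    · simpa using hp.not_adj_leaves (hdeg i) (hdeg k)

lemma exists_iso_triangleStar {u v p : V} (hp : IsLeafCenter G p) (hu : G.degree u = 2)
    (hv : G.degree v = 2) (hp3 : 3 ≤ G.degree p) (huv : G.Adj u v) (hpu : G.Adj p u)
    (hpv : G.Adj p v) (h : ∀ x, G.degree x = 1 ∨ x = p ∨ x = u ∨ x = v) :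
    ∃ j : ℕ, 1 ≤ j ∧ Nonempty (G ≃g triangleStar j) := by
  classical
  obtain ⟨j, e, he, hdeg, hsurj, hle⟩ := exists_leaf_enumeration G
  have hpe : ∀ i, p ≠ e i := fun i hi => hp.degree_ne_one (hi ▸ hdeg i)
  have hadj : ∀ a i, G.Adj (![p, u, v] a) (e i) ↔ a = 0 := by
    intro a i
    rw [G.adj_comm, hp _ (hdeg i)]
    fin_cases a <;> simp [hpu.ne', hpv.ne']
  refine ⟨j, ?_, nonempty_iso_of_bijective (f := Sum.elim ![p, u, v] e) ⟨?_, ?_⟩ ?_⟩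
  · have h1 := hle p {u, v} fun y hy => (h y).imp_right fun h' => by
      simpa using h'.resolve_left hy.ne'
    have h2 := Finset.card_le_two (a := u) (b := v)
    omega
  · refine Function.Injective.sumElim (injective_vec_three hpu.ne hpv.ne huv.ne) he ?_
    intro a i hai
    have hi := hdeg i
    rw [← hai] at hi
    fin_cases a
    exacts [hp.degree_ne_one hi, absurd (hu.symm.trans hi) (by simp), absurd (hv.symm.trans hi) (by simp)]
  · intro x
    obtain hx | rfl | rfl | rfl := h x
    · obtain ⟨i, hi⟩ := hsurj x hx
      exact ⟨Sum.inr i, hi⟩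
    exacts [⟨Sum.inl 0, rfl⟩, ⟨Sum.inl 1, rfl⟩, ⟨Sum.inl 2, rfl⟩]
  · rintro (a | i) (b | k)
    · exact adj_vec_three_iff hpu hpv huv a b
    · exact hadj a k
    · exact (G.adj_comm _ _).trans (hadj b i)
    · exact iff_of_false (hp.not_adj_leaves (hdeg i) (hdeg k)) id

lemma bijective_sumElim_sumElim {u v w p : V} {j : ℕ} {e : Fin j → V} (huv : u ≠ v) (huw : u ≠ w)
    (hvw : v ≠ w) (hup : u ≠ p) (hvp : v ≠ p) (hwp : w ≠ p) (he : Function.Injective e)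
    (hdeg : ∀ i, G.degree (e i) = 1) (hsurj : ∀ x, G.degree x = 1 → ∃ i, e i = x)
    (hu : G.degree u ≠ 1) (hv : G.degree v ≠ 1) (hw : G.degree w ≠ 1) (hp : G.degree p ≠ 1)
    (h : ∀ x, G.degree x = 1 ∨ x = p ∨ x = u ∨ x = v ∨ x = w) :
    Function.Bijective (Sum.elim ![u, v, w] (Sum.elim (fun _ : Fin 1 => p) e)) := by
  constructor
  · refine (injective_vec_three huv huw hvw).sumElim
      ((Function.injective_of_subsingleton _).sumElim he fun _ i hi => hp (hi ▸ hdeg i)) ?_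
    rintro a (b | i) hab
    · fin_cases a
      exacts [hup hab, hvp hab, hwp hab]
    · have := hdeg i
      rw [Sum.elim_inr] at hab
      rw [← hab] at this
      fin_cases a
      exacts [hu this, hv this, hw this]
  · intro x
    obtain hx | rfl | rfl | rfl | rfl := h x
    · obtain ⟨i, hi⟩ := hsurj x hx
      exact ⟨Sum.inr (Sum.inr i), hi⟩
    exacts [⟨Sum.inr (Sum.inl 0), rfl⟩, ⟨Sum.inl 0, rfl⟩, ⟨Sum.inl 1, rfl⟩, ⟨Sum.inl 2, rfl⟩]

lemma exists_iso_sum_triangle_star {u v w p : V} (hp : IsLeafCenter G p) (hp3 : 3 ≤ G.degree p)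
    (hu : G.degree u = 2) (hv : G.degree v = 2) (hw : G.degree w = 2)
    (huv : G.Adj u v) (huw : G.Adj u w) (hvw : G.Adj v w)
    (h : ∀ x, G.degree x = 1 ∨ x = p ∨ x = u ∨ x = v ∨ x = w) :
    ∃ j : ℕ, 3 ≤ j ∧ Nonempty (G ≃g SimpleGraph.sum triangle (star j)) := by
  obtain ⟨j, e, he, hdeg, hsurj, hle⟩ := exists_leaf_enumeration G
  have hup : u ≠ p := by rintro rfl; omega
  have hvp : v ≠ p := by rintro rfl; omega
  have hwp : w ≠ p := by rintro rfl; omega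
  have hpu : ¬ G.Adj p u := fun h => by
    have := (adj_iff_of_degree_eq_two hu huv huw hvw.ne p).1 h.symm
    grind
  have hpv : ¬ G.Adj p v := fun h => by
    have := (adj_iff_of_degree_eq_two hv huv.symm hvw huw.ne p).1 h.symm
    grind
  have hpw : ¬ G.Adj p w := fun h => by
    have := (adj_iff_of_degree_eq_two hw huw.symm hvw.symm huv.ne p).1 h.symm
    grind
  have hpadj : ∀ i, G.Adj (e i) p := fun i => (hp _ (hdeg i) p).2 rfl
  have hnp : ∀ a, ¬ G.Adj p (![u, v, w] a) := by
    intro a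
    fin_cases a
    exacts [hpu, hpv, hpw]
  have hne : ∀ a, ![u, v, w] a ≠ p := by
    intro a
    fin_cases a
    exacts [hup, hvp, hwp]
  have hnl : ∀ a i, ¬ G.Adj (e i) (![u, v, w] a) := fun a i hadj =>
    hne a ((hp _ (hdeg i) _).1 hadj)
  refine ⟨j, ?_, nonempty_iso_of_bijective (bijective_sumElim_sumElim huv.ne huw.ne hvw.ne hup hvp
    hwp he hdeg hsurj (by omega) (by omega) (by omega) (by omega) h) ?_⟩
  · have h1 := hle p ∅ fun y hy => Or.inl ((h y).resolve_right (by
      rintro (rfl | rfl | rfl | rfl)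
      exacts [hy.ne rfl, hpu hy, hpv hy, hpw hy]))
    rw [Finset.card_empty] at h1
    omega
  · rintro (a | a | i) (b | b | k)
    · simpa using adj_vec_three_iff huv huw hvw a b
    · simpa [G.adj_comm _ p] using hnp a
    · simpa [G.adj_comm _ (e k)] using hnl a k
    · simpa using hnp b
    · simp
    · simpa using (hpadj k).symm
    · simpa using hnl b i
    · simpa using hpadj i
    · simpa using hp.not_adj_leaves (hdeg i) (hdeg k)

lemma exists_iso_triangleEdgeStar {u v w p : V} (hp : IsLeafCenter G p) (hp4 : 4 ≤ G.degree p)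
    (hu : G.degree u = 2) (hv : G.degree v = 2) (hw : G.degree w = 3)
    (huv : G.Adj u v) (hwu : G.Adj w u) (hwv : G.Adj w v) (hwp : G.Adj w p)
    (h : ∀ x, G.degree x = 1 ∨ x = p ∨ x = w ∨ x = u ∨ x = v) :
    ∃ j : ℕ, 3 ≤ j ∧ Nonempty (G ≃g triangleEdgeStar j) := by
  obtain ⟨j, e, he, hdeg, hsurj, hle⟩ := exists_leaf_enumeration G
  have hup : u ≠ p := by rintro rfl; omega
  have hvp : v ≠ p := by rintro rfl; omega
  have hpu : ¬ G.Adj p u := fun h => by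
    have := (adj_iff_of_degree_eq_two hu huv hwu.symm hwv.ne' p).1 h.symm
    have := hwp.ne
    grind
  have hpv : ¬ G.Adj p v := fun h => by
    have := (adj_iff_of_degree_eq_two hv huv.symm hwv.symm hwu.ne' p).1 h.symm
    have := hwp.ne
    grind
  have hpadj : ∀ i, G.Adj (e i) p := fun i => (hp _ (hdeg i) p).2 rfl
  have hnp : ∀ a, G.Adj p (![w, u, v] a) ↔ a = 0 := by
    intro a
    fin_cases a <;> simp [hwp.symm, hpu, hpv]
  have hne : ∀ a, ![w, u, v] a ≠ p := by
    intro a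
    fin_cases a
    exacts [hwp.ne, hup, hvp]
  have hnl : ∀ a i, ¬ G.Adj (e i) (![w, u, v] a) := fun a i hadj =>
    hne a ((hp _ (hdeg i) _).1 hadj)
  refine ⟨j, ?_, nonempty_iso_of_bijective (bijective_sumElim_sumElim hwu.ne hwv.ne huv.ne hwp.ne
    hup hvp he hdeg hsurj (by omega) (by omega) (by omega) (by omega) h) ?_⟩
  · have h1 := hle p {w} fun y hy => by
      obtain h | rfl | rfl | rfl | rfl := h y
      exacts [Or.inl h, (hy.ne rfl).elim, Or.inr (by simp), (hpu hy).elim, (hpv hy).elim]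
    rw [Finset.card_singleton] at h1
    omega
  · rintro (a | a | i) (b | b | k)
    · simpa [triangleEdgeStar_adj] using adj_vec_three_iff hwu hwv huv a b
    · simpa [triangleEdgeStar_adj, G.adj_comm _ p, Subsingleton.elim b 0] using hnp a
    · simpa [triangleEdgeStar_adj, G.adj_comm _ (e k)] using hnl a k
    · simpa [triangleEdgeStar_adj, Subsingleton.elim a 0] using hnp b
    · simp [triangleEdgeStar_adj]
    · simpa [triangleEdgeStar_adj] using (hpadj k).symm
    · simpa [triangleEdgeStar_adj] using hnl b i
    · simpa [triangleEdgeStar_adj] using hpadj i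
    · simpa [triangleEdgeStar_adj] using hp.not_adj_leaves (hdeg i) (hdeg k)

end Assembly

/-- Without two vertices of degree two, the twin condition forces a star. -/
lemma TwinCondition.exists_isLeafCenter_forall_degree_eq_one [Nonempty V] (hT : TwinCondition G)
    (hpos : ∀ x, 0 < G.degree x)
    (h2 : ∀ u v, G.degree u = 2 → G.degree v = 2 → u = v) :
    ∃ p, IsLeafCenter G p ∧ ∀ x, x ≠ p → G.degree x = 1 := by
  by_cases hex : ∃ u, G.degree u = 2
  · obtain ⟨u, hu⟩ := hex
    obtain ⟨p, hp, -⟩ := hT.exists_isLeafCenter u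
    have hhigh : ∀ x, 3 ≤ G.degree x → x = p := fun x hx =>
      (hT.eq_or_eq_of_three_le_degree hpos hp (w := u)
        (fun x y _ _ hy => Or.inr (h2 y u hy hu)) hx).resolve_right (by rintro rfl; omega)
    -- A neighbor of $u \ne p$ is neither a leaf nor of degree two, so it has large degree and
    -- equals $p$; then $u$ would have degree at most one.
    have hpu : p = u := by
      by_contra hne
      have hsub : G.neighborFinset u ⊆ {p} := by
        intro y hy
        rw [SimpleGraph.mem_neighborFinset] at hy
        rw [Finset.mem_singleton]
        refine hhigh y ?_
        have h0 := hpos y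
        have h1 : G.degree y ≠ 1 := fun h => hne ((hp y h u).1 hy.symm).symm
        have h3 : G.degree y ≠ 2 := fun h => hy.ne (h2 u y hu h)
        omega
      have := Finset.card_le_card hsub
      rw [SimpleGraph.card_neighborFinset_eq_degree, Finset.card_singleton] at this
      omega
    refine ⟨p, hp, fun x hx => ?_⟩
    have h0 := hpos x
    have h1 : ¬ 3 ≤ G.degree x := fun h => hx (hhigh x h)
    have h3 : G.degree x ≠ 2 := fun h => hx ((h2 x u h hu).trans hpu.symm)
    omega
  · obtain ⟨p, hp, -⟩ := hT.exists_isLeafCenter (Classical.arbitrary V)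
    refine ⟨p, hp, fun x hx => ?_⟩
    have h0 := hpos x
    have h1 : ¬ 3 ≤ G.degree x := fun h => hx (or_self_iff.1
      (hT.eq_or_eq_of_three_le_degree hpos hp (w := p) (fun _ y _ _ hy => absurd ⟨y, hy⟩ hex) h))
    have h3 : G.degree x ≠ 2 := fun h => hex ⟨x, h⟩
    omega

/-- With two vertices $u, v$ of degree two and common neighbor $w$, every vertex is a leaf or one of
$p, u, v, w$. Whether $w$ has degree two and whether $p = w$ separates the four families containing
a triangle. -/
lemma TwinCondition.classification [Nonempty V] (hT : TwinCondition G)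
    (hpos : ∀ x, 0 < G.degree x) :
    Nonempty (G ≃g triangle) ∨ (∃ j : ℕ, 2 ≤ j ∧ Nonempty (G ≃g star j)) ∨
      (∃ j : ℕ, 1 ≤ j ∧ Nonempty (G ≃g triangleStar j)) ∨
      (∃ j : ℕ, 3 ≤ j ∧ Nonempty (G ≃g triangleEdgeStar j)) ∨
      (∃ j : ℕ, 3 ≤ j ∧ Nonempty (G ≃g SimpleGraph.sum triangle (star j))) := by
  classical
  by_cases htwo : ∀ u v, G.degree u = 2 → G.degree v = 2 → u = v
  · obtain ⟨p, hp, h⟩ := hT.exists_isLeafCenter_forall_degree_eq_one hpos htwo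
    exact Or.inr (Or.inl (exists_iso_star hpos hp h))
  push Not at htwo
  obtain ⟨u, v, hu, hv, huv⟩ := htwo
  have hadj2 : ∀ x y, x ≠ y → G.degree x = 2 → G.degree y = 2 → G.Adj x y := fun x y hne hx hy =>
    ((hT x y hne (hx.trans hy.symm)).1.resolve_left (by omega)).2
  obtain ⟨-, w, huw, hvw⟩ := hT u v huv (hu.trans hv.symm)
  replace huv := hadj2 u v huv hu hv
  have hNu := adj_iff_of_degree_eq_two hu huv huw hvw.ne
  have hNv := adj_iff_of_degree_eq_two hv huv.symm hvw huw.ne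
  have hdeg2 : ∀ x, G.degree x = 2 → x = u ∨ x = v ∨ x = w := by
    intro x hx
    by_cases hxu : x = u
    · exact Or.inl hxu
    · exact Or.inr ((hNu x).1 (hadj2 u x (Ne.symm hxu) hu hx))
  obtain ⟨p, hp, hpw⟩ := hT.exists_isLeafCenter w
  have hhigh : ∀ x, 3 ≤ G.degree x → x = p ∨ x = w := fun x hx =>
    hT.eq_or_eq_of_three_le_degree hpos hp (fun x y hxy hx hy => by
      obtain rfl | rfl | rfl := hdeg2 y hy
      · exact Or.inl (((hNu x).1 hxy.symm).resolve_left (by rintro rfl; omega))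
      · exact Or.inl (((hNv x).1 hxy.symm).resolve_left (by rintro rfl; omega))
      · exact Or.inr rfl) hx
  have hall : ∀ x, G.degree x = 1 ∨ x = p ∨ x = u ∨ x = v ∨ x = w := by
    intro x
    have h0 := hpos x
    obtain h | h | h : G.degree x = 1 ∨ G.degree x = 2 ∨ 3 ≤ G.degree x := by omega
    · exact Or.inl h
    · exact Or.inr (Or.inr (hdeg2 x h))
    · obtain h | h := hhigh x h
      exacts [Or.inr (Or.inl h), Or.inr (Or.inr (Or.inr (Or.inr h)))]
  have hwlow : G.degree w ≠ 1 := fun h => by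
    have h1 := (adj_iff_eq_of_degree_eq_one h huw.symm v).1 hvw.symm
    exact huv.ne h1.symm
  -- When $p \ne w$ there is a leaf at $p$; the neighbors of $u$ and $v$ are not leaves, so $p$ is
  -- neither, and its degree is at least three.
  have hleaf : p ≠ w → (∃ l, G.degree l = 1 ∧ G.Adj p l) ∧ p ≠ u ∧ p ≠ v ∧ 3 ≤ G.degree p := by
    intro hne
    obtain ⟨l, hl⟩ := hpw.resolve_left hne
    have hpl : G.Adj p l := ((hp l hl p).2 rfl).symm
    have hpu : p ≠ u := by
      rintro rfl
      obtain rfl | rfl := (hNu l).1 hpl <;> omega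
    have hpv : p ≠ v := by
      rintro rfl
      obtain rfl | rfl := (hNv l).1 hpl <;> omega
    refine ⟨⟨l, hl, hpl⟩, hpu, hpv, ?_⟩
    have h0 := hpos p
    have h1 := hp.degree_ne_one
    have h2 : G.degree p ≠ 2 := fun h => by
      obtain h | h | h := hdeg2 p h
      exacts [hpu h, hpv h, hne h]
    omega
  by_cases hw : G.degree w = 2
  · have hNw := adj_iff_of_degree_eq_two hw huw.symm hvw.symm huv.ne
    by_cases hpw' : p = w
    · subst hpw'
      by_cases hl : ∃ l, G.degree l = 1
      · obtain ⟨l, hl⟩ := hl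
        obtain rfl | rfl := (hNw l).1 ((hp l hl p).2 rfl).symm <;> omega
      · refine Or.inl (nonempty_iso_triangle huv huw hvw fun x => ?_)
        obtain h | h := (hall x).resolve_left fun h => hl ⟨x, h⟩
        exacts [Or.inr (Or.inr h), h]
    · exact Or.inr (Or.inr (Or.inr (Or.inr (exists_iso_sum_triangle_star hp (hleaf hpw').2.2.2
        hu hv hw huv huw hvw hall))))
  · have hw3 : 3 ≤ G.degree w := by
      have := hpos w
      omega
    by_cases hpw' : p = w
    · subst hpw'
      refine Or.inr (Or.inr (Or.inl (exists_iso_triangleStar hp hu hv hw3 huv huw.symm hvw.symm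
        fun x => ?_)))
      obtain h | h | h | h | h := hall x <;> simp [h]
    · obtain ⟨-, hpu, hpv, hp3⟩ := hleaf hpw'
      have hNw : ∀ y, G.Adj w y → y = p ∨ y = u ∨ y = v := fun y hy => by
        obtain h | h | h | h | h := hall y
        · exact absurd ((hp y h w).1 hy.symm).symm hpw'
        · exact Or.inl h
        · exact Or.inr (Or.inl h)
        · exact Or.inr (Or.inr h)
        · exact absurd h.symm hy.ne
      have hcard : ∀ E : Finset V, (∀ y, G.Adj w y → y ∈ E) → 3 ≤ E.card := fun E hE => by
        refine hw3.trans ?_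
        rw [← SimpleGraph.card_neighborFinset_eq_degree]
        exact Finset.card_le_card fun y hy => hE y ((G.mem_neighborFinset w y).1 hy)
      -- Otherwise only $u$ and $v$ could be neighbors of $w$, whose degree is at least three.
      have hwp : G.Adj w p := by
        by_contra hnot
        have h1 := hcard {u, v} fun y hy => by
          obtain rfl | h := hNw y hy
          · exact absurd hy hnot
          · simpa using h
        have h2 := Finset.card_le_two (a := u) (b := v)
        omega
      have hw3' : G.degree w = 3 := by
        refine le_antisymm ?_ hw3
        rw [← SimpleGraph.card_neighborFinset_eq_degree]
        refine (Finset.card_le_card (t := {p, u, v}) fun y hy => ?_).trans Finset.card_le_three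
        simpa using hNw y ((G.mem_neighborFinset w y).1 hy)
      -- Equal degrees of $p$ and $w$ would have to be at most two; this is the source of $j \ge 3$.
      have hp4 : G.degree p ≠ 3 := fun h => by
        have := (hT p w hpw' (h.trans hw3'.symm)).1
        omega
      refine Or.inr (Or.inr (Or.inr (Or.inl (exists_iso_triangleEdgeStar hp (by omega) hu hv hw3'
        huv huw.symm hvw.symm hwp fun x => ?_))))
      obtain h | h | h | h | h := hall x <;> simp [h]

end Structure

end PaletteIndex

theorem mainTheorem2 {V : Type*} [Finite V] [Nonempty V] (G : SimpleGraph V)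
    (hG : ∀ v : V, ¬ G.IsIsolated v) :
    PaletteIndex.paletteIndex G = Nat.card V ↔
      (Nonempty (G ≃g PaletteIndex.triangle) ∨
        (∃ j : ℕ, 2 ≤ j ∧ Nonempty (G ≃g PaletteIndex.star j)) ∨
        (∃ j : ℕ, 1 ≤ j ∧ Nonempty (G ≃g PaletteIndex.triangleStar j)) ∨
        (∃ j : ℕ, 3 ≤ j ∧ Nonempty (G ≃g PaletteIndex.triangleEdgeStar j)) ∨
        (∃ j : ℕ, 3 ≤ j ∧
          Nonempty (G ≃g SimpleGraph.sum PaletteIndex.triangle (PaletteIndex.star j)))) := by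
  classical
  have := Fintype.ofFinite V
  rw [PaletteIndex.paletteIndex_eq_card_iff_twinCondition]
  constructor
  · intro hT
    refine hT.classification fun x => ?_
    have hx := hG x
    simp only [SimpleGraph.IsIsolated, not_forall, not_not] at hx
    exact (G.degree_pos_iff_exists_adj x).2 hx
  · rintro (⟨⟨f⟩⟩ | ⟨j, hj, ⟨f⟩⟩ | ⟨j, hj, ⟨f⟩⟩ | ⟨j, hj, ⟨f⟩⟩ | ⟨j, hj, ⟨f⟩⟩)
    · exact PaletteIndex.twinCondition_triangle.of_iso f
    · exact (PaletteIndex.twinCondition_star hj).of_iso f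
    · exact (PaletteIndex.twinCondition_triangleStar hj).of_iso f
    · exact (PaletteIndex.twinCondition_triangleEdgeStar hj).of_iso f
    · exact (PaletteIndex.twinCondition_sum_triangle_star hj).of_iso f
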